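/- Let $G=(V,E)$ be a finite simple connected unweighted graph with vertices $v_1,\dots,v_k$, $k=|V|\ge 1$, and let $d$ be its shortest-path metric. Write $d(v,V\setminus\{v\})=\min_{w\ne v}d(v,w)$ (which equals $1$; by convention it is also $1$ when $k=1$), let $D_G=(d(v,w))_{v,w\in V}$ be the distance matrix, and let $\mathcal D_G=D_G+\mathrm{diag}(2d(v,V\setminus\{v\}))_{v\in V}=D_G+2\,\mathrm{Id}$ be the modified distance matrix. For a tuple $\mathbf n=(n_v)_{v\in V}$ of positive integers, the blowup $G[\mathbf n]$ is the metric space with $n_v$ copies of each $v\in V$, in which copies of distinct vertices $v,w$ are at distance $d(v,w)$ and distinct copies of the same vertex $v$ are at distance $2d(v,V\setminus\{v\})$; let $D_{G[\mathbf n]}$ be its distance matrix. The blowup-polynomial $p_G$ is the unique real polynomial in $k$ variables with $$\det D_{G[\mathbf n]}=p_G(\mathbf n)\prod_{v\in V}\bigl(-2d(v,V\setminus\{v\})\bigr)^{n_v-1}\quad\text{for all tuples }\mathbf n\text{ of positive integers};$$ explicitly, $p_G(\mathbf z)=\det\bigl(\mathrm{diag}(-2d(v,V\setminus\{v\}))_{v}+\mathrm{diag}(z_v)_{v}\,\mathcal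 D_G\bigr)$. Define the homogenized blowup-polynomial $$\widetilde p_G(z_0,z_1,\dots,z_k):=(-z_0)^k\,p_G\!\left(\frac{z_1}{-z_0},\dots,\frac{z_k}{-z_0}\right)\in\mathbb R[z_0,z_1,\dots,z_k].$$ A polynomial with real coefficients is called real-stable if it does not vanish when all its arguments lie in the open upper half-plane. A polynomial is called strongly Rayleigh if it is multi-affine, real-stable, and has nonnegative coefficients that sum to $1$. Then the following are equivalent: 1. $\widetilde p_G(z_0,z_1,\dots,z_k)$ is real-stable. 2. All coefficients of $\widetilde p_G$ are nonnegative. 3. $(-1)^k p_G(-1,\dots,-1)>0$, and the polynomial $(z_1,\dots,z_k)\mapsto \dfrac{p_G(-z_1,\dots,-z_k)}{p_G(-1,\dots,-1)}$ is strongly Rayleigh. 4. The modified distance matrix $\mathcal D_G=D_G+2\,\mathrm{Id}$ is positive semidefinite. 5. $G$ is a complete multipartite graph. -/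

import Mathlib

namespace BlowupPoly

open MvPolynomial

section Defs

variable {V : Type*} [Fintype V] [DecidableEq V]

/-- The distance `d(v, V \ {v}) = inf_{w ≠ v} d(v, w)` from a vertex to the other vertices, for the
shortest-path metric of `G`. When `v` is the only vertex the infimum is over the empty set, and the
value is `1` by convention. -/
noncomputable def nearestDist (G : SimpleGraph V) (v : V) : ℝ :=
  open Classical in
  if ∃ w, w ≠ v then ⨅ w : {w : V // w ≠ v}, (G.dist v w : ℝ) else 1

/-- The distance matrix `D_G` of the shortest-path metric. -/
noncomputable def distMatrix (G : SimpleGraph V) : Matrix V V ℝ :=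
  Matrix.of fun v w => (G.dist v w : ℝ)

/-- The modified distance matrix `𝒟_G = D_G + diag (2 d(v, V \ {v}))`. -/
noncomputable def modifiedDistMatrix (G : SimpleGraph V) : Matrix V V ℝ :=
  distMatrix G + Matrix.diagonal fun v => 2 * nearestDist G v

/-- The distance matrix of the `n`-blowup of `G`, whose points are `n v` copies of each vertex `v`:
copies of distinct vertices `v, w` are at distance `d(v, w)`, distinct copies of the same vertex
`v` are at distance `2 d(v, V \ {v})`. -/
noncomputable def blowupDistMatrix (G : SimpleGraph V) (n : V → ℕ) :
    Matrix (Σ v, Fin (n v)) (Σ v, Fin (n v)) ℝ :=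
  Matrix.of fun x y =>
    if x = y then 0 else if x.1 = y.1 then 2 * nearestDist G x.1 else (G.dist x.1 y.1 : ℝ)

/-- The matrix `diag (a_v) + diag (n_v) 𝒟_G`, with `a_v = - 2 d(v, V \ {v})`, over the polynomial
ring in the indeterminates `n_v`. -/
noncomputable def blowupMatrix (G : SimpleGraph V) : Matrix V V (MvPolynomial V ℝ) :=
  Matrix.diagonal (fun v => C (-2 * nearestDist G v)) +
    Matrix.diagonal (fun v => X v) * (modifiedDistMatrix G).map C

/-- The blowup-polynomial `p_G`, in closed form. By `existsUnique_blowupPolynomial` and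
`det_blowupDistMatrix` below it is the unique polynomial with
`det D_{G[n]} = p_G(n) * ∏ v, (-2 d(v, V \ {v})) ^ (n_v - 1)` for all tuples `n` of positive
integers. -/
noncomputable def blowupPolynomial (G : SimpleGraph V) : MvPolynomial V ℝ :=
  (blowupMatrix G).det

/-- For `p` of total degree at most `k`, the polynomial `(-z₀)^k p(z / (-z₀))`, where the new
variable `z₀` is indexed by `none` and the old ones by `some v`. -/
noncomputable def homogenizeNeg (k : ℕ) {σ : Type*} (p : MvPolynomial σ ℝ) :
    MvPolynomial (Option σ) ℝ :=
  ∑ m ∈ p.support, (-X none) ^ (k - m.degree) * rename some (monomial m (p.coeff m))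

/-- The homogenized blowup-polynomial `(-z₀)^k p_G(z / (-z₀))` with `k = |V|`. -/
noncomputable def homogenizedBlowupPolynomial (G : SimpleGraph V) : MvPolynomial (Option V) ℝ :=
  homogenizeNeg (Fintype.card V) (blowupPolynomial G)

/-- A real polynomial is real-stable if it has no zeros with all the coordinates in the open upper
half-plane. -/
def IsRealStable {σ : Type*} (p : MvPolynomial σ ℝ) : Prop :=
  ∀ z : σ → ℂ, (∀ i, 0 < (z i).im) → aeval z p ≠ 0

/-- A strongly Rayleigh polynomial: multi-affine, real-stable, and with nonnegative coefficients
that sum up to `1` (that is, a real-stable generating polynomial of a probability measure on the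
subsets of `σ`). -/
structure IsStronglyRayleigh {σ : Type*} (p : MvPolynomial σ ℝ) : Prop where
  multiAffine : ∀ i, p.degreeOf i ≤ 1
  realStable : IsRealStable p
  coeff_nonneg : ∀ m, 0 ≤ p.coeff m
  sum_coeff : ∑ m ∈ p.support, p.coeff m = 1

/-- The normalized reflected polynomial `p_G(-z) / p_G(-1, …, -1)`. -/
noncomputable def reflectedBlowupPolynomial (G : SimpleGraph V) : MvPolynomial V ℝ :=
  C (eval (fun _ => -1) (blowupPolynomial G))⁻¹ * aeval (fun v => -X v) (blowupPolynomial G)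

end Defs

/-! ### Checks that the definitions are the intended ones -/

section Checks

variable {V : Type*} [Fintype V] [DecidableEq V]

theorem nearestDist_eq_one {G : SimpleGraph V} (hG : G.Connected) (v : V) :
    nearestDist G v = 1 := by
  unfold nearestDist
  split_ifs with h
  · obtain ⟨w, hw⟩ := h
    have : Nontrivial V := ⟨⟨w, v, hw⟩⟩
    obtain ⟨u, hu⟩ := hG.preconnected.exists_adj_of_nontrivial v
    have hb : BddBelow (Set.range fun w : {w : V // w ≠ v} => (G.dist v w : ℝ)) :=
      ⟨0, by rintro _ ⟨w, rfl⟩; positivity⟩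
    have : Nonempty {w : V // w ≠ v} := ⟨⟨w, hw⟩⟩
    apply le_antisymm
    · refine (ciInf_le hb ⟨u, hu.ne'⟩).trans ?_
      simp [SimpleGraph.dist_eq_one_iff_adj.2 hu]
    · refine le_ciInf fun w => ?_
      have := hG.pos_dist_of_ne (Ne.symm w.2)
      exact_mod_cast this
  · rfl

/-- `𝒟_G = D_G + 2 Id`. -/
theorem modifiedDistMatrix_eq {G : SimpleGraph V} (hG : G.Connected) :
    modifiedDistMatrix G = distMatrix G + (2 : ℝ) • (1 : Matrix V V ℝ) := by
  unfold modifiedDistMatrix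
  congr 1
  ext v w
  simp [nearestDist_eq_one hG, Matrix.diagonal_apply, Matrix.one_apply]

theorem eval_blowupPolynomial (G : SimpleGraph V) (x : V → ℝ) :
    eval x (blowupPolynomial G) =
      (Matrix.diagonal (fun v => -2 * nearestDist G v) +
        Matrix.diagonal x * modifiedDistMatrix G).det := by
  unfold blowupPolynomial
  rw [RingHom.map_det]
  congr 1
  ext v w
  simp [blowupMatrix, Matrix.diagonal_apply, Matrix.diagonal_mul, apply_ite]

/-- The determinants of the distance matrices of the blowups of `G`. -/
theorem det_blowupDistMatrix {G : SimpleGraph V} (hG : G.Connected) (n : V → ℕ)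
    (hn : ∀ v, 0 < n v) :
    (blowupDistMatrix G n).det =
      eval (fun v => (n v : ℝ)) (blowupPolynomial G) *
        ∏ v, (-2 * nearestDist G v) ^ (n v - 1) := by
  let U : Matrix (Σ v, Fin (n v)) V ℝ := Matrix.of fun x v => if x.1 = v then 1 else 0
  have h1 : blowupDistMatrix G n =
      (-2 : ℝ) • (1 + U * ((-1 / 2 : ℝ) • (modifiedDistMatrix G * U.transpose))) := by
    ext x y
    simp only [blowupDistMatrix, modifiedDistMatrix_eq hG, Matrix.of_apply, Matrix.smul_apply,
      Matrix.add_apply, Matrix.mul_apply, U, Matrix.transpose_apply, Matrix.one_apply,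
      distMatrix, nearestDist_eq_one hG, smul_eq_mul]
    simp
    by_cases hxy : x = y
    · subst hxy; simp
    · by_cases h : x.1 = y.1
      · simp [hxy, h]
      · simp [hxy, h]
        ring
  have h2 : U.transpose * U = Matrix.diagonal (fun v => (n v : ℝ)) := by
    ext v w
    simp only [Matrix.mul_apply, U, Matrix.transpose_apply, Matrix.of_apply, Fintype.sum_sigma]
    simp only [Matrix.diagonal_apply]
    by_cases h : v = w
    · simp [h]
    · simp [h, Ne.symm h]
  rw [h1, Matrix.det_smul, Matrix.det_one_add_mul_comm, eval_blowupPolynomial]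
  have h3 : Matrix.diagonal (fun v => -2 * nearestDist G v) +
        Matrix.diagonal (fun v => (n v : ℝ)) * modifiedDistMatrix G =
      (-2 : ℝ) • (1 + (-1 / 2 : ℝ) •
        (Matrix.diagonal (fun v => (n v : ℝ)) * modifiedDistMatrix G)) := by
    ext v w
    simp [nearestDist_eq_one hG, Matrix.diagonal_apply, Matrix.one_apply]
    split_ifs <;> ring
  have h4 : (1 + (-1 / 2 : ℝ) • (modifiedDistMatrix G * U.transpose) * U).det =
      (1 + (-1 / 2 : ℝ) •
        (Matrix.diagonal (fun v => (n v : ℝ)) * modifiedDistMatrix G)).det := by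
    rw [Matrix.smul_mul, Matrix.mul_assoc, h2, ← Matrix.mul_smul, Matrix.det_one_add_mul_comm,
      Matrix.smul_mul]
  rw [h3, Matrix.det_smul, h4]
  have h5 : (-2 : ℝ) ^ Fintype.card (Σ v, Fin (n v)) =
      (-2) ^ Fintype.card V * ∏ v, (-2 * nearestDist G v) ^ (n v - 1) := by
    simp only [nearestDist_eq_one hG, mul_one, Fintype.card_sigma, Fintype.card_fin]
    rw [Finset.prod_pow_eq_pow_sum, ← pow_add]
    congr 1
    rw [Fintype.card_eq_sum_ones, ← Finset.sum_add_distrib]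
    exact Finset.sum_congr rfl fun v _ => by have := hn v; omega
  rw [h5]; ring

/-- The blowup-polynomial is characterized by the determinants of the blowups. -/
theorem existsUnique_blowupPolynomial {G : SimpleGraph V} (hG : G.Connected) :
    ∃! p : MvPolynomial V ℝ, ∀ n : V → ℕ, (∀ v, 0 < n v) →
      (blowupDistMatrix G n).det =
        eval (fun v => (n v : ℝ)) p * ∏ v, (-2 * nearestDist G v) ^ (n v - 1) := by
  refine ⟨blowupPolynomial G, det_blowupDistMatrix hG, fun q hq => ?_⟩
  refine funext_set (fun _ => Set.range fun m : ℕ => ((m + 1 : ℕ) : ℝ)) (fun _ => ?_) ?_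
  · exact Set.infinite_range_of_injective fun a b h => by simpa using h
  · intro x hx
    choose m hm using fun v => hx v (Set.mem_univ v)
    have hne : ∏ v, (-2 * nearestDist G v) ^ (m v + 1 - 1) ≠ 0 :=
      Finset.prod_ne_zero_iff.2 fun v _ => by simp [nearestDist_eq_one hG]
    have h := (hq (fun v => m v + 1) (fun v => Nat.succ_pos _)).symm.trans
      (det_blowupDistMatrix hG (fun v => m v + 1) fun v => Nat.succ_pos _)
    have hx' : x = fun v => ((m v + 1 : ℕ) : ℝ) := funext fun v => (hm v).symm
    rw [hx']
    exact mul_right_cancel₀ hne h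

theorem totalDegree_blowupPolynomial_le (G : SimpleGraph V) :
    (blowupPolynomial G).totalDegree ≤ Fintype.card V := by
  unfold blowupPolynomial
  rw [Matrix.det_apply]
  refine totalDegree_finsetSum_le fun s _ => (totalDegree_smul_le _ _).trans ?_
  refine (totalDegree_finsetProd _ _).trans ?_
  rw [Fintype.card_eq_sum_ones]
  refine Finset.sum_le_sum fun v _ => ?_
  simp only [blowupMatrix, Matrix.add_apply, Matrix.diagonal_mul, Matrix.map_apply]
  refine (totalDegree_add _ _).trans (max_le ?_ ?_)
  · rw [Matrix.diagonal_apply]; split_ifs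
    · rw [totalDegree_C]; exact Nat.zero_le _
    · simp
  · exact (totalDegree_mul _ _).trans (by simp [totalDegree_X])

/-- `p̃_G(z₀, z) = (-z₀)^k p_G(z / (-z₀))` for all complex `z₀ ≠ 0`. -/
theorem aeval_homogenizedBlowupPolynomial (G : SimpleGraph V) (z : Option V → ℂ)
    (hz : z none ≠ 0) :
    aeval z (homogenizedBlowupPolynomial G) =
      (-z none) ^ Fintype.card V *
        aeval (fun v => z (some v) / (-z none)) (blowupPolynomial G) := by
  have hz' : -z none ≠ 0 := neg_ne_zero.2 hz
  conv_rhs => rw [aeval_def, eval₂_eq]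
  rw [homogenizedBlowupPolynomial, homogenizeNeg, map_sum, Finset.mul_sum]
  refine Finset.sum_congr rfl fun m hm => ?_
  have hd : m.degree ≤ Fintype.card V :=
    (le_totalDegree hm).trans (totalDegree_blowupPolynomial_le G)
  have e : (∏ i ∈ m.support, (-z none) ^ m i) = (-z none) ^ m.degree := by
    rw [Finset.prod_pow_eq_pow_sum]; rfl
  simp only [map_mul, map_pow, map_neg, aeval_X, aeval_rename, aeval_monomial, div_pow,
    Finset.prod_div_distrib, e, Finsupp.prod, Function.comp]
  rw [pow_sub₀ _ hz' hd]
  field_simp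

end Checks

end BlowupPoly

/-! Every condition is compared with positive semidefiniteness of `𝒟 = modifiedDistMatrix G`. All
three polynomial conditions rest on `det (2 z₀ + diag z * 𝒟)`, the value of the homogenized
polynomial at `z₀ ≠ 0`; the reflected one is its slice `z₀ = 1`, up to a nonzero factor. If `𝒟` is
positive semidefinite, pairing a kernel vector with itself rules out zeros in the upper half-plane
(`det_diagonal_add_diagonal_mul_ne_zero`), and the coefficients are, up to sign and powers of two,
principal minors of `𝒟` (`coeff_blowupPolynomial`). Conversely, each condition excludes zeros of
`p_G` at `(-s, …, -s)` with `s > 0`, whereas an eigenvalue `μ < 0` of `𝒟` gives one at `s = -2 / μ`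
(`posSemidef_of_eval_ne_zero`). On the graph side, a complete multipartite graph has `𝒟` equal to
the all-ones matrix plus the indicator of "same part"; any other graph has an edge and a vertex
adjacent to neither end, where a 3 × 3 minor admits a negative test vector. -/

namespace BlowupPoly

open MvPolynomial

/-! ### Determinants of `diag a + diag b * C`: expansion and nonvanishing. -/

section Determinant

variable {n R : Type*} [Fintype n] [DecidableEq n] [CommRing R]

/-- Expansion of `det (diag a + diag b * C)` in the principal minors of `C`. -/
theorem det_diagonal_add_diagonal_mul (a b : n → R) (C : Matrix n n R) :
    (Matrix.diagonal a + Matrix.diagonal b * C).det =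
      ∑ s : Finset n, (∏ i ∈ s, a i) * ((∏ i ∈ sᶜ, b i) *
        (C.submatrix (Subtype.val : {i // i ∉ s} → n) Subtype.val).det) := by
  have h := (Matrix.detRowAlternating (R := R) (n := n)).map_add_univ
    (Matrix.diagonal a) (Matrix.diagonal b * C)
  refine h.trans (Finset.sum_congr rfl fun s _ => ?_)
  change Matrix.det (Matrix.of (s.piecewise (Matrix.diagonal a) (Matrix.diagonal b * C))) = _
  set M : Matrix n n R := Matrix.of (s.piecewise (Matrix.diagonal a) (Matrix.diagonal b * C))
  have hM : ∀ i j, M i j = if i ∈ s then Matrix.diagonal a i j else b i * C i j := by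
    intro i j
    simp only [M, Matrix.of_apply, Finset.piecewise]
    split_ifs <;> simp [Matrix.diagonal_mul]
  -- Rows in `s` come from `diag a` and vanish off `s`, so `M` is block triangular.
  rw [Matrix.twoBlockTriangular_det' M (fun i => i ∈ s)]
  · have h1 : M.toSquareBlockProp (fun i => i ∈ s) =
        Matrix.diagonal (fun i : {i // i ∈ s} => a i) := by
      ext i j
      simp only [Matrix.toSquareBlockProp_def, Matrix.of_apply, hM, i.2, if_true,
        Matrix.diagonal_apply, Subtype.ext_iff]
    have h2 : M.toSquareBlockProp (fun i => ¬ i ∈ s) =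
        Matrix.diagonal (fun i : {i // i ∉ s} => b i) *
          C.submatrix (Subtype.val : {i // i ∉ s} → n) Subtype.val := by
      ext i j
      simp only [Matrix.toSquareBlockProp_def, Matrix.of_apply, hM, i.2, if_false,
        Matrix.diagonal_mul, Matrix.submatrix_apply]
    rw [h1, h2, Matrix.det_mul, @Matrix.det_diagonal _ _ (Subtype.fintype (· ∈ s)), Matrix.det_diagonal,
      ← Finset.prod_subtype s (fun x => Iff.rfl) a,
      ← Finset.prod_subtype sᶜ (fun x => by simp) b]
  · intro i hi j hj
    have : i ≠ j := fun h => hj (h ▸ hi)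
    simp [hM, hi, this]

open scoped ComplexOrder MatrixOrder in
/-- If `C` is positive semidefinite, then `det (2 c + diag z * C)` does not vanish for `z` in the
open upper half-plane and nonzero `c` in the closed upper half-plane. -/
theorem det_diagonal_add_diagonal_mul_ne_zero {C : Matrix n n ℝ} (hC : C.PosSemidef) {c : ℂ}
    (hc : 0 ≤ c.im) (hc0 : c ≠ 0) {z : n → ℂ} (hz : ∀ i, 0 < (z i).im) :
    (Matrix.diagonal (fun _ => 2 * c) + Matrix.diagonal z * C.map Complex.ofReal).det ≠ 0 := by
  intro h
  obtain ⟨v, hv, hMv⟩ := Matrix.exists_mulVec_eq_zero_iff.2 h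
  have hz0 : ∀ i, z i ≠ 0 := fun i h0 => by simpa [h0] using hz i
  have hCc : (C.map Complex.ofReal).PosSemidef := by
    obtain ⟨B, rfl⟩ := CStarAlgebra.nonneg_iff_eq_star_mul_self.1 hC.nonneg
    rw [Matrix.star_eq_conjTranspose]
    have : (B.conjTranspose * B).map Complex.ofReal =
        (B.map Complex.ofReal).conjTranspose * B.map Complex.ofReal := by
      ext i j
      simp [Matrix.mul_apply]
    rw [this]
    exact Matrix.posSemidef_conjTranspose_mul_self _
  have hq := hCc.dotProduct_mulVec_nonneg v
  have hcomp : ∀ i, ((C.map Complex.ofReal).mulVec v) i = -(2 * c) * (v i / z i) := by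
    intro i
    have := congrFun hMv i
    rw [Matrix.add_mulVec, ← Matrix.mulVec_mulVec] at this
    simp only [Pi.add_apply, Matrix.mulVec_diagonal, Pi.zero_apply] at this
    field_simp [hz0 i]
    linear_combination this
  -- Pairing the kernel equation with `v` gives `v* C v = -2 c S`; each `1 / z i` lies in the lower
  -- half-plane, hence so does `S`.
  set S : ℂ := ∑ i, (Complex.normSq (v i) : ℂ) / z i with hS
  have hqS : star v ⬝ᵥ (C.map Complex.ofReal).mulVec v = -(2 * c) * S := by
    simp only [dotProduct, hcomp, hS, Finset.mul_sum]
    refine Finset.sum_congr rfl fun i _ => ?_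
    rw [Complex.normSq_eq_conj_mul_self]
    simp only [Pi.star_apply, RCLike.star_def]
    ring
  have hSim : S.im < 0 := by
    have him : ∀ i, ((Complex.normSq (v i) : ℂ) / z i).im =
        -(Complex.normSq (v i) * ((z i).im / Complex.normSq (z i))) := by
      intro i
      rw [div_eq_mul_inv, Complex.im_ofReal_mul, Complex.inv_im]
      ring
    rw [hS, Complex.im_sum]
    simp only [him]
    rw [Finset.sum_neg_distrib, neg_lt_zero]
    obtain ⟨i, hi⟩ := Function.ne_iff.1 hv
    refine Finset.sum_pos' (fun j _ => ?_) ⟨i, Finset.mem_univ i, ?_⟩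
    · exact mul_nonneg (Complex.normSq_nonneg _)
        (div_nonneg (hz j).le (Complex.normSq_nonneg _))
    · exact mul_pos (Complex.normSq_pos.2 hi) (div_pos (hz i) (Complex.normSq_pos.2 (hz0 i)))
  rw [hqS, Complex.nonneg_iff] at hq
  obtain ⟨h1, h2⟩ := hq
  simp only [Complex.mul_re, Complex.mul_im, Complex.neg_re, Complex.neg_im, Complex.re_ofNat,
    Complex.im_ofNat, zero_mul, sub_zero, add_zero] at h1 h2
  -- Now `c S` is real and nonpositive, so multiplying it by the conjugate of `c` gives `|c|² Im S =
  -- -Im c · Re (c S) ≥ 0`, against `Im S < 0`.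
  have hn : 0 < c.re * c.re + c.im * c.im := by
    simpa [Complex.normSq_apply] using Complex.normSq_pos.2 hc0
  have h4 : c.im * (c.re * S.re - c.im * S.im) ≤ 0 :=
    mul_nonpos_of_nonneg_of_nonpos hc (by linarith)
  have h5 : (c.re * c.re + c.im * c.im) * S.im < 0 := mul_neg_of_pos_of_neg hn hSim
  have h6 : c.re * S.im + c.im * S.re = 0 := by linarith
  have h7 : (c.re * c.re + c.im * c.im) * S.im = -(c.im * (c.re * S.re - c.im * S.im)) := by
    linear_combination c.re * h6
  linarith

end Determinant

/-! ### Monotonicity, reflection and real points of polynomials. -/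

section NonnegativeCoefficients

theorem eval_le_eval_of_coeff_nonneg {σ : Type*} {p : MvPolynomial σ ℝ}
    (hp : ∀ m, 0 ≤ p.coeff m) {x y : σ → ℝ} (hx : ∀ i, 0 ≤ x i) (hxy : ∀ i, x i ≤ y i) :
    eval x p ≤ eval y p := by
  rw [eval_eq, eval_eq]
  refine Finset.sum_le_sum fun m _ => mul_le_mul_of_nonneg_left ?_ (hp m)
  exact Finset.prod_le_prod (fun i _ => pow_nonneg (hx i) _)
    fun i _ => pow_le_pow_left₀ (hx i) (hxy i) _

theorem coeff_aeval_neg_X {σ : Type*} (p : MvPolynomial σ ℝ) (m : σ →₀ ℕ) :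
    (aeval (fun i => -X i : σ → MvPolynomial σ ℝ) p).coeff m = (-1) ^ m.degree * p.coeff m := by
  classical
  induction p using MvPolynomial.induction_on' with
  | monomial u a =>
    have h : aeval (fun i => -X i : σ → MvPolynomial σ ℝ) (monomial u a) =
        monomial u ((-1) ^ u.degree * a) := by
      rw [aeval_monomial, monomial_eq, Finsupp.prod, Finsupp.prod]
      simp only [neg_pow (X _ : MvPolynomial σ ℝ), Finset.prod_mul_distrib,
        Finset.prod_pow_eq_pow_sum, C_mul, C_pow, C_neg, C_1, algebraMap_eq]
      rw [show ∑ i ∈ u.support, u i = u.degree from rfl]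
      ring
    rw [h, coeff_monomial, coeff_monomial]
    split_ifs with hu
    · rw [hu]
    · simp
  | add p q hp hq => rw [map_add, coeff_add, coeff_add, hp, hq, mul_add]

theorem aeval_ofReal {σ : Type*} (x : σ → ℝ) (p : MvPolynomial σ ℝ) :
    aeval (fun i => (x i : ℂ)) p = (eval x p : ℂ) := by
  have := aeval_algebraMap_apply (A := ℝ) ℂ x p
  simpa [aeval_eq_eval, Function.comp_def] using this

end NonnegativeCoefficients

/-! ### Complete multipartite graphs and semidefiniteness. -/

section Graph

variable {V : Type*} {G : SimpleGraph V}

theorem two_le_dist (hG : G.Connected) {v w : V} (hne : v ≠ w) (h : ¬ G.Adj v w) :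
    2 ≤ G.dist v w := by
  have h0 := hG.pos_dist_of_ne hne
  have h1 : G.dist v w ≠ 1 := fun h1 => h (SimpleGraph.dist_eq_one_iff_adj.1 h1)
  omega

theorem dist_eq_two (hG : G.Connected) (hM : G.IsCompleteMultipartite) {v w : V} (hne : v ≠ w)
    (h : ¬ G.Adj v w) : G.dist v w = 2 := by
  refine le_antisymm ?_ (two_le_dist hG hne h)
  have : Nontrivial V := ⟨⟨v, w, hne⟩⟩
  obtain ⟨u, hu⟩ := hG.preconnected.exists_adj_of_nontrivial v
  -- Non-adjacency is transitive, so any neighbour of `v` is also a neighbour of `w`.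
  have huw : G.Adj u w := by
    by_contra huw
    exact hM.trans v w u h (fun h' => huw h'.symm) hu
  simpa using SimpleGraph.dist_le (.cons hu (.cons huw .nil))

variable [Fintype V] [DecidableEq V]

theorem modifiedDistMatrix_apply (hG : G.Connected) (v w : V) :
    modifiedDistMatrix G v w = if v = w then 2 else (G.dist v w : ℝ) := by
  rw [modifiedDistMatrix_eq hG]
  by_cases h : v = w <;> simp [distMatrix, h]

theorem isHermitian_modifiedDistMatrix (hG : G.Connected) :
    (modifiedDistMatrix G).IsHermitian := by
  ext v w
  simp [modifiedDistMatrix_apply hG, SimpleGraph.dist_comm, eq_comm]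

/-- Entries are 2 within a part (diagonal included) and 1 across parts, which makes the matrix a sum
of two Gram matrices. -/
theorem posSemidef_modifiedDistMatrix (hG : G.Connected) (hM : G.IsCompleteMultipartite) :
    (modifiedDistMatrix G).PosSemidef := by
  classical
  let s : Setoid V := hM.setoid
  let U : Matrix V (Quotient s) ℝ := Matrix.of fun v c => if (⟦v⟧ : Quotient s) = c then 1 else 0
  let J : Matrix V Unit ℝ := Matrix.of fun _ _ => 1
  have hs : ∀ v w : V, (⟦v⟧ : Quotient s) = ⟦w⟧ ↔ ¬ G.Adj v w := fun v w => Quotient.eq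
  have h : modifiedDistMatrix G = J * J.conjTranspose + U * U.conjTranspose := by
    ext v w
    rw [modifiedDistMatrix_apply hG]
    simp only [Matrix.add_apply, Matrix.mul_apply, U, J, Matrix.of_apply,
      Matrix.conjTranspose_apply, star_trivial, mul_ite, mul_one, mul_zero,
      Finset.sum_ite_eq, Finset.mem_univ, if_true, hs]
    split_ifs with hvw hadj hadj
    · subst hvw; exact absurd hadj (by simp)
    · norm_num
    · simp [SimpleGraph.dist_eq_one_iff_adj.2 hadj]
    · norm_num [dist_eq_two hG hM hvw hadj]
  rw [h]
  exact (Matrix.posSemidef_self_mul_conjTranspose J).add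
    (Matrix.posSemidef_self_mul_conjTranspose U)

theorem isCompleteMultipartite_of_posSemidef (hG : G.Connected)
    (h : (modifiedDistMatrix G).PosSemidef) : G.IsCompleteMultipartite := by
  by_contra hM
  obtain ⟨v, w₁, w₂, hP⟩ := G.exists_isPathGraph3Compl_of_not_isCompleteMultipartite hM
  have h1 : (2 : ℝ) ≤ G.dist v w₁ := by exact_mod_cast two_le_dist hG hP.ne_fst hP.not_adj_fst
  have h2 : (2 : ℝ) ≤ G.dist v w₂ := by exact_mod_cast two_le_dist hG hP.ne_snd hP.not_adj_snd
  have h3 : G.dist w₁ w₂ = 1 := SimpleGraph.dist_eq_one_iff_adj.2 hP.adj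
  -- The quadratic form here is `14 - 4 (d(v, w₁) + d(v, w₂))`, at most `-2` since both distances
  -- are at least 2.
  have hq := (h.submatrix ![v, w₁, w₂]).dotProduct_mulVec_nonneg ![-2, 1, 1]
  simp only [dotProduct, Matrix.mulVec, Fin.sum_univ_three, Matrix.submatrix_apply,
    modifiedDistMatrix_apply hG] at hq
  simp [hP.ne_fst, hP.ne_snd, hP.fst_ne_snd, hP.ne_fst.symm, hP.ne_snd.symm, hP.fst_ne_snd.symm,
    SimpleGraph.dist_comm (u := w₁) (v := v), SimpleGraph.dist_comm (u := w₂) (v := v),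
    SimpleGraph.dist_comm (u := w₂) (v := w₁), h3] at hq
  linarith

end Graph

/-! ### Coefficients, stability and zeros of the blowup-polynomials. -/

section Polynomial

variable {V : Type*} [Fintype V] [DecidableEq V] {G : SimpleGraph V}

theorem aeval_blowupPolynomial (hG : G.Connected) (z : V → ℂ) :
    aeval z (blowupPolynomial G) =
      (Matrix.diagonal (fun _ => (-2 : ℂ)) +
        Matrix.diagonal z * (modifiedDistMatrix G).map Complex.ofReal).det := by
  unfold blowupPolynomial
  rw [AlgHom.map_det]
  congr 1
  ext v w
  simp [blowupMatrix, Matrix.diagonal_apply, Matrix.diagonal_mul, apply_ite,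
    nearestDist_eq_one hG]

theorem eval_homogenizedBlowupPolynomial (G : SimpleGraph V) (x : Option V → ℝ)
    (hx : x none ≠ 0) :
    eval x (homogenizedBlowupPolynomial G) =
      (-x none) ^ Fintype.card V *
        eval (fun v => x (some v) / (-x none)) (blowupPolynomial G) := by
  have h := aeval_homogenizedBlowupPolynomial G (fun i => (x i : ℂ)) (by exact_mod_cast hx)
  have h' : (fun v => (x (some v) : ℂ) / (-(x none : ℂ))) =
      fun v => ((x (some v) / (-x none) : ℝ) : ℂ) := by
    funext v; push_cast; rfl
  rw [h', aeval_ofReal, aeval_ofReal] at h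
  exact_mod_cast h

theorem eval_zero_blowupPolynomial (hG : G.Connected) :
    eval (fun _ => (0 : ℝ)) (blowupPolynomial G) = (-2) ^ Fintype.card V := by
  rw [eval_blowupPolynomial]
  simp [nearestDist_eq_one hG, show (Matrix.diagonal fun _ : V => (0 : ℝ)) = 0 from
    Matrix.diagonal_zero]

/-- The coefficients of `p_G` in terms of the principal minors of `𝒟_G`. -/
theorem coeff_blowupPolynomial (hG : G.Connected) (m : V →₀ ℕ) :
    (blowupPolynomial G).coeff m = ∑ s : Finset V,
      if (∑ i ∈ sᶜ, Finsupp.single i 1) = m then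
        (-2) ^ s.card * ((modifiedDistMatrix G).submatrix
          (Subtype.val : {i // i ∉ s} → V) Subtype.val).det
      else 0 := by
  unfold blowupPolynomial blowupMatrix
  rw [det_diagonal_add_diagonal_mul, coeff_sum]
  refine Finset.sum_congr rfl fun s _ => ?_
  have h1 : ∏ i ∈ sᶜ, (X i : MvPolynomial V ℝ) = monomial (∑ i ∈ sᶜ, Finsupp.single i 1) 1 := by
    simp only [X, monomial_sum_one]
  have h2 : (((modifiedDistMatrix G).map C).submatrix
      (Subtype.val : {i // i ∉ s} → V) Subtype.val).det =
      C (σ := V) ((modifiedDistMatrix G).submatrix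
        (Subtype.val : {i // i ∉ s} → V) Subtype.val).det := by
    rw [RingHom.map_det]
    rfl
  rw [h1, h2]
  simp only [nearestDist_eq_one hG, mul_one, Finset.prod_const, ← C_pow]
  rw [mul_comm (monomial _ _), ← mul_assoc, ← C_mul, C_mul_monomial, mul_one, coeff_monomial]

theorem degree_sum_single {σ : Type*} (s : Finset σ) :
    (∑ i ∈ s, Finsupp.single i 1 : σ →₀ ℕ).degree = s.card := by
  rw [map_sum]
  simp

theorem coeff_blowupPolynomial_nonneg (hG : G.Connected) (h : (modifiedDistMatrix G).PosSemidef)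
    (m : V →₀ ℕ) :
    0 ≤ (-1) ^ (Fintype.card V + m.degree) * (blowupPolynomial G).coeff m := by
  rw [coeff_blowupPolynomial hG, Finset.mul_sum]
  refine Finset.sum_nonneg fun s _ => ?_
  split_ifs with hm
  · rw [← hm, degree_sum_single, ← mul_assoc, ← Finset.card_add_card_compl s]
    refine mul_nonneg ?_ (h.submatrix _).det_nonneg
    have : (-1 : ℝ) ^ (s.card + sᶜ.card + sᶜ.card) * (-2) ^ s.card = 2 ^ s.card := by
      rw [add_assoc, pow_add, ← two_mul sᶜ.card, pow_mul, mul_right_comm, ← mul_pow]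
      norm_num
    rw [this]
    positivity
  · simp

theorem le_one_of_coeff_blowupPolynomial_ne_zero (hG : G.Connected) {m : V →₀ ℕ}
    (hm : (blowupPolynomial G).coeff m ≠ 0) (i : V) : m i ≤ 1 := by
  rw [coeff_blowupPolynomial hG] at hm
  obtain ⟨s, -, hs⟩ := Finset.exists_ne_zero_of_sum_ne_zero hm
  obtain ⟨rfl, -⟩ := ite_ne_right_iff.1 hs
  rw [Finsupp.finsetSum_apply]
  simp only [Finsupp.single_apply, Finset.sum_ite_eq']
  split_ifs <;> simp

theorem coeff_reflectedBlowupPolynomial (G : SimpleGraph V) (m : V →₀ ℕ) :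
    (reflectedBlowupPolynomial G).coeff m =
      (eval (fun _ => -1) (blowupPolynomial G))⁻¹ *
        ((-1) ^ m.degree * (blowupPolynomial G).coeff m) := by
  rw [reflectedBlowupPolynomial, coeff_C_mul, coeff_aeval_neg_X]

theorem eval_reflectedBlowupPolynomial (G : SimpleGraph V) (x : V → ℝ) :
    eval x (reflectedBlowupPolynomial G) =
      (eval (fun _ => -1) (blowupPolynomial G))⁻¹ * eval (fun v => -x v) (blowupPolynomial G) := by
  rw [reflectedBlowupPolynomial, map_mul, eval_C]
  congr 1
  have := comp_aeval_apply (fun v => -X v : V → MvPolynomial V ℝ) (aeval x) (blowupPolynomial G)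
  simpa [aeval_eq_eval] using this

/-- A negative eigenvalue of `𝒟_G` produces a zero of `p_G` on the negative diagonal. -/
theorem posSemidef_of_eval_ne_zero (hG : G.Connected)
    (h : ∀ s : ℝ, 0 < s → eval (fun _ => -s) (blowupPolynomial G) ≠ 0) :
    (modifiedDistMatrix G).PosSemidef := by
  have hH := isHermitian_modifiedDistMatrix hG
  rw [hH.posSemidef_iff_eigenvalues_nonneg]
  intro i
  by_contra! hi
  have hi : hH.eigenvalues i < 0 := hi
  -- With `s = -2 / μ`, the matrix `-2 - s 𝒟` kills the eigenvector for `μ`.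
  refine h (-2 / hH.eigenvalues i) (div_pos_of_neg_of_neg (by norm_num) hi) ?_
  rw [eval_blowupPolynomial, ← Matrix.exists_mulVec_eq_zero_iff]
  refine ⟨hH.eigenvectorBasis i, ?_, ?_⟩
  · intro h0
    apply hH.eigenvectorBasis.toBasis.ne_zero i
    ext j
    simpa using congrFun h0 j
  · rw [Matrix.add_mulVec, ← Matrix.mulVec_mulVec, hH.mulVec_eigenvectorBasis]
    ext j
    simp only [Pi.add_apply, Matrix.mulVec_diagonal, nearestDist_eq_one hG, Pi.smul_apply,
      smul_eq_mul, Pi.zero_apply]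
    field_simp [hi.ne]
    ring

theorem isRealStable_homogenizedBlowupPolynomial (hG : G.Connected)
    (h : (modifiedDistMatrix G).PosSemidef) : IsRealStable (homogenizedBlowupPolynomial G) := by
  intro z hz
  have h0 : z none ≠ 0 := fun h0 => by simpa [h0] using hz none
  rw [aeval_homogenizedBlowupPolynomial G z h0, aeval_blowupPolynomial hG, ← Matrix.det_smul]
  convert det_diagonal_add_diagonal_mul_ne_zero h (hz none).le h0 (fun v => hz (some v)) using 2
  ext v w
  simp only [Matrix.smul_apply, Matrix.add_apply, Matrix.diagonal_mul, Matrix.diagonal_apply,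
    smul_eq_mul]
  split_ifs <;> field_simp <;> ring

theorem isRealStable_reflectedBlowupPolynomial (hG : G.Connected)
    (h : (modifiedDistMatrix G).PosSemidef)
    (h0 : eval (fun _ => -1) (blowupPolynomial G) ≠ 0) :
    IsRealStable (reflectedBlowupPolynomial G) := by
  intro z hz
  rw [reflectedBlowupPolynomial, map_mul, comp_aeval_apply, aeval_C]
  refine mul_ne_zero (by simpa using h0) ?_
  have hd := det_diagonal_add_diagonal_mul_ne_zero h (c := 1) (by simp) one_ne_zero hz
  simp only [map_neg, aeval_X]
  rw [aeval_blowupPolynomial hG]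
  intro h1
  apply hd
  rw [← neg_eq_zero, ← neg_neg (Matrix.diagonal (fun _ => (2 : ℂ) * 1) + _), Matrix.det_neg]
  rw [neg_eq_zero]
  convert mul_zero _
  rw [← h1]
  congr 1
  ext v w
  simp only [Matrix.neg_apply, Matrix.add_apply, Matrix.diagonal_mul, Matrix.diagonal_apply]
  split_ifs <;> ring

theorem coeff_homogenizedBlowupPolynomial_nonneg (hG : G.Connected)
    (h : (modifiedDistMatrix G).PosSemidef) (m : Option V →₀ ℕ) :
    0 ≤ (homogenizedBlowupPolynomial G).coeff m := by
  rw [homogenizedBlowupPolynomial, homogenizeNeg, coeff_sum]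
  refine Finset.sum_nonneg fun u hu => ?_
  -- This bound keeps the exponent `k - u.degree` from being truncated, so its parity is that of `k
  -- + u.degree`.
  have hd : u.degree ≤ Fintype.card V :=
    (le_totalDegree hu).trans (totalDegree_blowupPolynomial_le G)
  have he : (-X none : MvPolynomial (Option V) ℝ) ^ (Fintype.card V - u.degree) *
      rename some (monomial u ((blowupPolynomial G).coeff u)) =
      monomial (Finsupp.single none (Fintype.card V - u.degree) + u.mapDomain some)
        ((-1) ^ (Fintype.card V + u.degree) * (blowupPolynomial G).coeff u) := by
    have hs : (-1 : ℝ) ^ (Fintype.card V + u.degree) = (-1) ^ (Fintype.card V - u.degree) := by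
      conv_lhs => rw [← Nat.sub_add_cancel hd]
      rw [add_assoc, pow_add, ← two_mul, pow_mul]
      norm_num
    rw [rename_monomial, neg_pow, X_pow_eq_monomial, mul_assoc, monomial_mul, one_mul, hs,
      ← C_mul_monomial]
    simp
  rw [he, coeff_monomial]
  split_ifs
  · exact coeff_blowupPolynomial_nonneg hG h u
  · exact le_rfl

/-- The homogenized polynomial is monotone on the nonnegative orthant, so its value at `(1, …, 1)`
is at least its value `2 ^ k` at `(1, 0, …, 0)`. -/
theorem eval_neg_one_blowupPolynomial_pos (hG : G.Connected)
    (h : (modifiedDistMatrix G).PosSemidef) :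
    0 < (-1 : ℝ) ^ Fintype.card V * eval (fun _ => (-1 : ℝ)) (blowupPolynomial G) := by
  have hnn := coeff_homogenizedBlowupPolynomial_nonneg hG h
  have h1 := eval_homogenizedBlowupPolynomial G (fun _ => 1) one_ne_zero
  have h0 := eval_homogenizedBlowupPolynomial G (fun i => if i = none then 1 else 0) (by simp)
  have hle := eval_le_eval_of_coeff_nonneg hnn (x := fun i => if i = none then 1 else 0)
    (y := fun _ => 1) (fun i => by split_ifs <;> simp) (fun i => by split_ifs <;> simp)
  simp only [reduceCtorEq, if_false, if_true, zero_div, eval_zero_blowupPolynomial hG,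
    ← mul_pow] at h0
  rw [h0, h1] at hle
  norm_num at hle
  exact lt_of_lt_of_le (by positivity) hle

theorem isStronglyRayleigh_reflectedBlowupPolynomial (hG : G.Connected)
    (h : (modifiedDistMatrix G).PosSemidef) :
    IsStronglyRayleigh (reflectedBlowupPolynomial G) := by
  have hpos := eval_neg_one_blowupPolynomial_pos hG h
  have h0 : eval (fun _ => (-1 : ℝ)) (blowupPolynomial G) ≠ 0 := right_ne_zero_of_mul hpos.ne'
  refine ⟨fun i => ?_, isRealStable_reflectedBlowupPolynomial hG h h0, fun m => ?_, ?_⟩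
  · rw [degreeOf_le_iff]
    intro m hm
    rw [mem_support_iff, coeff_reflectedBlowupPolynomial] at hm
    exact le_one_of_coeff_blowupPolynomial_ne_zero hG
      (right_ne_zero_of_mul (right_ne_zero_of_mul hm)) i
  · rw [coeff_reflectedBlowupPolynomial]
    have hc := coeff_blowupPolynomial_nonneg hG h m
    have hsq : ((-1 : ℝ) ^ Fintype.card V) * (-1) ^ Fintype.card V = 1 := by
      rw [← mul_pow]; norm_num
    have := mul_nonneg (inv_nonneg.2 hpos.le) hc
    rw [mul_inv, pow_add] at this
    have hinv : ((-1 : ℝ) ^ Fintype.card V)⁻¹ = (-1) ^ Fintype.card V :=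
      inv_eq_of_mul_eq_one_left hsq
    rw [hinv] at this
    refine this.trans_eq ?_
    linear_combination (eval (fun _ => (-1 : ℝ)) (blowupPolynomial G))⁻¹ * (-1) ^ m.degree *
      (blowupPolynomial G).coeff m * hsq
  · have := eval_reflectedBlowupPolynomial G (fun _ => 1)
    rw [inv_mul_cancel₀ h0, eval_eq] at this
    simpa using this

theorem posSemidef_of_isRealStable (hG : G.Connected)
    (h : IsRealStable (homogenizedBlowupPolynomial G)) : (modifiedDistMatrix G).PosSemidef := by
  refine posSemidef_of_eval_ne_zero hG fun s hs h0 => ?_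
  -- At this point every ratio `z / (-z₀)` equals `-s`.
  refine h (fun i => if i = none then Complex.I else s * Complex.I)
    (fun i => by split_ifs <;> simp [hs]) ?_
  rw [aeval_homogenizedBlowupPolynomial G _ (by simp)]
  have : (fun _ : V => (s : ℂ) * Complex.I / -Complex.I) = fun _ : V => ((-s : ℝ) : ℂ) := by
    funext v
    have := Complex.I_ne_zero
    push_cast
    field_simp
  simp only [reduceCtorEq, if_false, if_true, this, aeval_ofReal, h0, Complex.ofReal_zero, mul_zero]

/-- By monotonicity, a zero of `p_G` at `(-s, …, -s)` would force `2 ^ k ≤ 0`. -/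
theorem posSemidef_of_coeff_nonneg (hG : G.Connected)
    (h : ∀ m, 0 ≤ (homogenizedBlowupPolynomial G).coeff m) :
    (modifiedDistMatrix G).PosSemidef := by
  refine posSemidef_of_eval_ne_zero hG fun s hs hz => ?_
  have h1 := eval_homogenizedBlowupPolynomial G (fun i => if i = none then 1 else s) (by simp)
  have h0 := eval_homogenizedBlowupPolynomial G (fun i => if i = none then 1 else 0) (by simp)
  have hle := eval_le_eval_of_coeff_nonneg h (x := fun i => if i = none then 1 else 0)
    (y := fun i => if i = none then 1 else s) (fun i => by split_ifs <;> simp)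
    (fun i => by split_ifs <;> simp [hs.le])
  simp only [reduceCtorEq, if_false, if_true, zero_div, eval_zero_blowupPolynomial hG,
    ← mul_pow] at h0
  simp only [reduceCtorEq, if_false, if_true, div_neg, div_one, hz, mul_zero] at h1
  rw [h0, h1] at hle
  norm_num at hle
  exact absurd hle (not_le.2 (by positivity))

theorem posSemidef_of_isStronglyRayleigh (hG : G.Connected)
    (hpos : 0 < (-1 : ℝ) ^ Fintype.card V * eval (fun _ => (-1 : ℝ)) (blowupPolynomial G))
    (h : IsStronglyRayleigh (reflectedBlowupPolynomial G)) :
    (modifiedDistMatrix G).PosSemidef := by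
  refine posSemidef_of_eval_ne_zero hG fun s hs hz => ?_
  have hle := eval_le_eval_of_coeff_nonneg h.coeff_nonneg (x := fun _ => 0) (y := fun _ => s)
    (fun _ => le_rfl) (fun _ => hs.le)
  rw [eval_reflectedBlowupPolynomial, eval_reflectedBlowupPolynomial, hz] at hle
  simp only [neg_zero, eval_zero_blowupPolynomial hG, mul_zero] at hle
  -- This is the reflected polynomial's value at the origin, `(-2) ^ k / p_G(-1, …, -1)`, with the
  -- signs paired off; monotonicity would make it nonpositive.
  have h2 : (0 : ℝ) < ((-1) ^ Fintype.card V * eval (fun _ => (-1 : ℝ)) (blowupPolynomial G))⁻¹ *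
      2 ^ Fintype.card V := mul_pos (inv_pos.2 hpos) (by positivity)
  rw [mul_inv, ← inv_pow, mul_comm (((-1 : ℝ)⁻¹) ^ _), mul_assoc, ← mul_pow] at h2
  norm_num at h2
  linarith

end Polynomial

end BlowupPoly

theorem theoremE {V : Type*} [Fintype V] [DecidableEq V] (G : SimpleGraph V) (hG : G.Connected) :
    List.TFAE [
      BlowupPoly.IsRealStable (BlowupPoly.homogenizedBlowupPolynomial G),
      ∀ m : Option V →₀ ℕ, 0 ≤ (BlowupPoly.homogenizedBlowupPolynomial G).coeff m,
      0 < (-1 : ℝ) ^ Fintype.card V *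
          MvPolynomial.eval (fun _ => (-1 : ℝ)) (BlowupPoly.blowupPolynomial G) ∧
        BlowupPoly.IsStronglyRayleigh (BlowupPoly.reflectedBlowupPolynomial G),
      (BlowupPoly.modifiedDistMatrix G).PosSemidef,
      G.IsCompleteMultipartite] := by
  tfae_have 1 → 4 := BlowupPoly.posSemidef_of_isRealStable hG
  tfae_have 2 → 4 := BlowupPoly.posSemidef_of_coeff_nonneg hG
  tfae_have 3 → 4 := fun h => BlowupPoly.posSemidef_of_isStronglyRayleigh hG h.1 h.2
  tfae_have 4 → 1 := BlowupPoly.isRealStable_homogenizedBlowupPolynomial hG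
  tfae_have 4 → 2 := BlowupPoly.coeff_homogenizedBlowupPolynomial_nonneg hG
  tfae_have 4 → 3 := fun h => ⟨BlowupPoly.eval_neg_one_blowupPolynomial_pos hG h,
    BlowupPoly.isStronglyRayleigh_reflectedBlowupPolynomial hG h⟩
  tfae_have 4 → 5 := BlowupPoly.isCompleteMultipartite_of_posSemidef hG
  tfae_have 5 → 4 := BlowupPoly.posSemidef_modifiedDistMatrix hG
  tfae_finish
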